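/- **Conventions.** A *stratified set* is a simplicial set $X$ together with a set of *thin* simplices which contains every degenerate simplex and no $0$-simplex; stratified maps are the simplicial maps which preserve thinness. Let $\mathrm{Strat}$ be the category of stratified sets. The *lax Gray tensor* $X\otimes Y$ of stratified sets has underlying simplicial set $X\times Y$, and an $n$-simplex $(x,y)$ of it is thin iff for every partition $n=p+q$ either the face of $x$ on the vertices $0,\dots,p$ is thin in $X$ or the face of $y$ on the vertices $p,\dots,n$ is thin in $Y$. With unit $\Delta[0]$ and the structure isomorphisms of the cartesian product of simplicial sets this is a monoidal structure on $\mathrm{Strat}$. Write $\mathrm{Strat}_\otimes\text{-}\mathrm{Cat}$ for the category of categories enriched in $(\mathrm{Strat},\otimes,\Delta[0])$ (with composition $\mathcal E(b,c)\otimes\mathcal E(a,b)\to\mathcal E(a,c)$) and enriched functors. Standard simplices $\Delta[n]$ carry the minimal stratification (only degenerate simplices are thin). Let $\bar S$ be the locally ordered category with objects the natural numbers, in which $\bar S(r,s)$ is empty if $s<r$, is $\{()\}$ if $s=r$, and is $\{(a_s,\dots,a_{r+1})\in\{0<1\}^{s-r}\mid a_s=0\}$ with the pointwise order if $r<s$;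 composition is concatenation of tuples. Let $S_\otimes$ be the $\mathrm{Strat}_\otimes$-category whose hom $S_\otimes(r,s)$ has as underlying simplicial set the nerve of $\bar S(r,s)$, stratified as a regular subset of the tensor power $\Delta[1]^{\otimes(s-r)}$ (a simplex is thin iff it is thin there; the factors correspond, from left to right, to the indices $s,s-1,\dots,r+1$). Let $S_\otimes[n]$ be the full enriched subcategory on the objects $0,1,\dots,n$. A simplicial operator $\alpha\colon[n]\to[m]$ induces an enriched functor $S_\otimes[n]\to S_\otimes[m]$, given on objects by $\alpha$ and on homs by the unique functorial, pointwise order preserving action which sends each tuple $\langle r,s\rangle=(0,1,\dots,1)\in\bar S(r,s)$, $r<s$, to $\langle\alpha(r),\alpha(s)\rangle$ (where $\langle t,t\rangle$ is the identity). This gives a functor $S_\otimes[-]\colon\Delta\to\mathrm{Strat}_\otimes\text{-}\mathrm{Cat}$. The *nerve* of a $\mathrm{Strat}_\otimes$-category $\mathcal E$ is the simplicial set $N(\mathcal E)$ whose $n$-simplices are the enriched functors $S_\otimes[n]\to\mathcal E$, with simplicial operators acting by precomposition; enriched functors act on nerves by postcomposition. **Lemma.** The nerve functor $N\colon\mathrm{Strat}_\otimes\text{-}\mathrm{Cat}\to\mathrm{Simp}$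 is faithful. -/

import Mathlib

open CategoryTheory MonoidalCategory Simplicial Opposite

universe u w

namespace StratGray

/-- A stratified set: a simplicial set with a chosen set of thin simplices, containing all
degenerate simplices and no `0`-simplices. -/
structure Strat : Type (u + 1) where
  toSSet : SSet.{u}
  thin : ∀ n : ℕ, Set (toSSet _⦋n⦌)
  degenerate_subset : ∀ n : ℕ, toSSet.degenerate n ⊆ thin n
  thin_zero : thin 0 = ∅

namespace Strat

/-- A stratified map: a simplicial map which preserves thinness. -/
@[ext]
structure Hom (X Y : Strat.{u}) : Type u where
  toMap : X.toSSet ⟶ Y.toSSet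
  map_thin : ∀ (n : ℕ) (x : X.toSSet _⦋n⦌), x ∈ X.thin n → toMap.app (op ⦋n⦌) x ∈ Y.thin n

instance : Category Strat.{u} where
  Hom := Hom
  id X := ⟨𝟙 _, fun _ _ h => h⟩
  comp f g := ⟨f.toMap ≫ g.toMap, fun n x h => g.map_thin n _ (f.map_thin n x h)⟩

/-- The functor forgetting stratifications. -/
def forget : Strat.{u} ⥤ SSet.{u} where
  obj X := X.toSSet
  map f := Hom.toMap f

theorem hom_ext {X Y : Strat.{u}} {f g : X ⟶ Y} (h : Hom.toMap f = Hom.toMap g) : f = g :=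
  Hom.ext h

instance : forget.{u}.Faithful where
  map_injective h := hom_ext h

/-- The minimal stratification: only degenerate simplices are thin. -/
def minimal (X : SSet.{u}) : Strat.{u} where
  toSSet := X
  thin := X.degenerate
  degenerate_subset _ := subset_rfl
  thin_zero := X.degenerate_zero

/-- The stratification on `X` induced along `f : X ⟶ Y`: a simplex is thin when its image is.
When `f` is injective this presents `X` as a regular subset of `Y`. -/
def induced {X : SSet.{u}} {Y : Strat.{u}} (f : X ⟶ Y.toSSet) : Strat.{u} where
  toSSet := X
  thin n := {x | f.app (op ⦋n⦌) x ∈ Y.thin n}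
  degenerate_subset n _ hx := Y.degenerate_subset n (SSet.degenerate_app_apply hx f)
  thin_zero := by
    ext x
    simp [Y.thin_zero]

theorem map_mem_degenerate {X : SSet.{u}} {p m : ℕ} (g : ⦋p⦌ ⟶ ⦋m⦌) (x : X _⦋m⦌)
    (hg : ¬ Function.Injective g.toOrderHom) : X.map g.op x ∈ X.degenerate p := by
  cases p with
  | zero =>
    exact (hg (Function.injective_of_subsingleton (α := Fin 1) _)).elim
  | succ p =>
    obtain ⟨i, θ, rfl⟩ := SimplexCategory.eq_σ_comp_of_not_injective g hg
    exact ⟨p, by omega, SimplexCategory.σ i, X.map θ.op x, by simp⟩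

/-- The lax Gray tensor product. Its underlying simplicial set is the product, and an `n`-simplex
`(x, y)` is thin iff for each partition `p + q = n` either the front `p`-face of `x` is thin or the
back `q`-face of `y` is thin. -/
def laxTensor (X Y : Strat.{u}) : Strat.{u} where
  toSSet := X.toSSet ⊗ Y.toSSet
  thin n := {z | ∀ (p q : ℕ) (h : p + q = n),
    X.toSSet.map (SimplexCategory.subinterval 0 p (by omega)).op z.1 ∈ X.thin p ∨
    Y.toSSet.map (SimplexCategory.subinterval p q (by omega)).op z.2 ∈ Y.thin q}
  degenerate_subset n := by
    rintro z ⟨m, hm, f, ⟨y, rfl⟩⟩ p q h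
    have hf : ¬ Function.Injective f.toOrderHom := fun hi => by
      have := Fintype.card_le_of_injective _ hi
      simp at this
      omega
    by_contra! hcon
    obtain ⟨h1, h2⟩ := hcon
    refine hf (fun a b hab => ?_)
    have e1 : Function.Injective
        (SimplexCategory.subinterval 0 p (by omega : 0 + p ≤ n) ≫ f).toOrderHom := by
      by_contra hc
      refine h1 (X.degenerate_subset _ ?_)
      have := map_mem_degenerate (X := X.toSSet) _ y.1 hc
      rw [op_comp, Functor.map_comp] at this
      exact this
    have e2 : Function.Injective
        (SimplexCategory.subinterval p q (by omega : p + q ≤ n) ≫ f).toOrderHom := by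
      by_contra hc
      refine h2 (Y.degenerate_subset _ ?_)
      have := map_mem_degenerate (X := Y.toSSet) _ y.2 hc
      rw [op_comp, Functor.map_comp] at this
      exact this
    have key : ∀ a b : Fin (n + 1), a < b → f.toOrderHom a ≠ f.toOrderHom b := by
      intro a b hab hfab
      obtain ⟨a, ha⟩ := a
      obtain ⟨b, hb⟩ := b
      have hab' : a < b := hab
      have ha'' : a < n + 1 := ha
      have hb'' : b < n + 1 := hb
      by_cases hp : a < p
      · have hle : f.toOrderHom ⟨a, ha⟩ =
            f.toOrderHom ⟨a + 1, show a + 1 < n + 1 by omega⟩ := by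
          refine le_antisymm (f.toOrderHom.monotone (Fin.mk_le_mk.2 (by omega))) ?_
          rw [hfab]
          exact f.toOrderHom.monotone (Fin.mk_le_mk.2 (by omega))
        have := @e1 ⟨a, by simp; omega⟩ ⟨a + 1, by simp; omega⟩ hle
        simp at this
      · have ha' : a - p + p = a := by omega
        have hb' : b - p + p = b := by omega
        have := @e2 ⟨a - p, by simp; omega⟩ ⟨b - p, by simp; omega⟩ (by
          simp only [SimplexCategory.subinterval]
          refine (congrArg f.toOrderHom (Fin.ext ha')).trans
            (hfab.trans (congrArg f.toOrderHom (Fin.ext hb'.symm))))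
        simp at this
        omega
    by_contra hne
    rcases lt_or_gt_of_ne hne with hlt | hlt
    · exact key a b hlt hab
    · exact key b a hlt hab.symm
  thin_zero := by
    ext z
    simp only [Set.mem_ofPred_eq, Set.mem_empty_iff_false, iff_false, not_forall]
    refine ⟨0, 0, rfl, ?_⟩
    simp [X.thin_zero, Y.thin_zero]

theorem mem_thin_laxTensor {X Y : Strat.{u}} {n : ℕ} (z : (laxTensor X Y).toSSet _⦋n⦌) :
    z ∈ (laxTensor X Y).thin n ↔ ∀ (p q : ℕ) (h : p + q = n),
      X.toSSet.map (SimplexCategory.subinterval 0 p (by omega)).op z.1 ∈ X.thin p ∨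
      Y.toSSet.map (SimplexCategory.subinterval p q (by omega)).op z.2 ∈ Y.thin q :=
  Iff.rfl

/-- The lax Gray tensor of stratified maps. -/
def laxTensorHom {X Y X' Y' : Strat.{u}} (f : X ⟶ X') (g : Y ⟶ Y') :
    laxTensor X Y ⟶ laxTensor X' Y' where
  toMap := Hom.toMap f ⊗ₘ Hom.toMap g
  map_thin n z hz p q h := by
    rcases hz p q h with h1 | h1
    · left
      have := Hom.map_thin f p _ h1
      rw [NatTrans.naturality_apply] at this
      exact this
    · right
      have := Hom.map_thin g q _ h1
      rw [NatTrans.naturality_apply] at this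
      exact this

theorem map_subinterval_comp (X : SSet.{u}) {n a b c d : ℕ} (x : X _⦋n⦌) (h : a + b ≤ n)
    (h' : c + d ≤ b) :
    X.map (SimplexCategory.subinterval c d h').op (X.map (SimplexCategory.subinterval a b h).op x) =
      X.map (SimplexCategory.subinterval (a + c) d (by omega)).op x := by
  rw [← Functor.map_comp_apply, ← op_comp]
  have : SimplexCategory.subinterval c d h' ≫ SimplexCategory.subinterval a b h =
      SimplexCategory.subinterval (a + c) d (by omega) := by
    ext i
    show (i : ℕ) + c + a = (i : ℕ) + (a + c)
    omega
  rw [this]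

theorem map_subinterval_self (X : SSet.{u}) {n : ℕ} (x : X _⦋n⦌) (h : 0 + n ≤ n) :
    X.map (SimplexCategory.subinterval 0 n h).op x = x := by
  have : SimplexCategory.subinterval 0 n h = 𝟙 _ := by
    ext i
    simp [SimplexCategory.subinterval]
  rw [this]
  simp

theorem mem_degenerate_unit {n : ℕ} (x : (𝟙_ SSet.{u}) _⦋n⦌) :
    x ∈ (𝟙_ SSet.{u}).degenerate n ↔ 0 < n := by
  constructor
  · rintro ⟨m, hm, -⟩
    omega
  · intro h
    exact ⟨0, h, ⦋n⦌.const ⦋0⦌ 0, x, rfl⟩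

theorem mem_thin_laxTensor_assoc {X Y Z : Strat.{u}} {n : ℕ}
    (w : (laxTensor (laxTensor X Y) Z).toSSet _⦋n⦌) :
    w ∈ (laxTensor (laxTensor X Y) Z).thin n ↔
      (α_ X.toSSet Y.toSSet Z.toSSet).hom.app (op ⦋n⦌) w ∈
        (laxTensor X (laxTensor Y Z)).thin n := by
  obtain ⟨⟨x, y⟩, z⟩ := w
  constructor
  · intro h p q hpq
    by_cases hP : X.toSSet.map (SimplexCategory.subinterval 0 p (by omega)).op x ∈ X.thin p
    · exact Or.inl hP
    · refine Or.inr (fun p' q' hpq' => ?_)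
      rcases h (p + p') q' (by omega) with h1 | h1
      · have h2 := (h1 p p' rfl).resolve_left (fun h3 => hP (by
          erw [map_subinterval_comp] at h3
          exact h3))
        left
        erw [map_subinterval_comp] at h2 ⊢
        convert h2 using 3
        simp
        rfl
      · right
        erw [map_subinterval_comp]
        exact h1
  · intro h p q hpq
    by_cases hR : Z.toSSet.map (SimplexCategory.subinterval p q (by omega)).op z ∈ Z.thin q
    · exact Or.inr hR
    · refine Or.inl (fun p' q' hpq' => ?_)
      rcases h p' (q' + q) (by omega) with h1 | h1
      · left
        erw [map_subinterval_comp]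
        exact h1
      · have h2 := (h1 q' q rfl).resolve_right (fun h3 => hR (by
          subst hpq'
          erw [map_subinterval_comp] at h3
          exact h3))
        right
        erw [map_subinterval_comp] at h2 ⊢
        convert h2 using 3
        simp
        rfl

/-- The unit `Δ[0]` of the lax Gray tensor product. -/
def unit : Strat.{u} := minimal (𝟙_ SSet.{u})

theorem mem_thin_unit_laxTensor {X : Strat.{u}} {n : ℕ}
    (z : (laxTensor unit X).toSSet _⦋n⦌) :
    z ∈ (laxTensor unit X).thin n ↔ (λ_ X.toSSet).hom.app (op ⦋n⦌) z ∈ X.thin n := by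
  obtain ⟨t, x⟩ := z
  constructor
  · intro h
    rcases h 0 n (by omega) with h1 | h1
    · exact (((mem_degenerate_unit _).1 h1).ne rfl).elim
    · erw [map_subinterval_self] at h1
      exact h1
  · intro h p q hpq
    rcases Nat.eq_zero_or_pos p with rfl | hp
    · right
      obtain rfl : q = n := by omega
      erw [map_subinterval_self]
      exact h
    · exact Or.inl ((mem_degenerate_unit _).2 hp)

theorem mem_thin_laxTensor_unit {X : Strat.{u}} {n : ℕ}
    (z : (laxTensor X unit).toSSet _⦋n⦌) :
    z ∈ (laxTensor X unit).thin n ↔ (ρ_ X.toSSet).hom.app (op ⦋n⦌) z ∈ X.thin n := by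
  obtain ⟨x, t⟩ := z
  constructor
  · intro h
    rcases h n 0 (by omega) with h1 | h1
    · erw [map_subinterval_self] at h1
      exact h1
    · exact (((mem_degenerate_unit _).1 h1).ne rfl).elim
  · intro h p q hpq
    rcases Nat.eq_zero_or_pos q with rfl | hq
    · left
      obtain rfl : p = n := by omega
      erw [map_subinterval_self]
      exact h
    · exact Or.inr ((mem_degenerate_unit _).2 hq)

/-- An isomorphism of underlying simplicial sets which preserves and reflects thinness. -/
def isoMk {X Y : Strat.{u}} (e : X.toSSet ≅ Y.toSSet)
    (h : ∀ (n : ℕ) (x : X.toSSet _⦋n⦌), x ∈ X.thin n ↔ e.hom.app (op ⦋n⦌) x ∈ Y.thin n) :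
    X ≅ Y where
  hom := ⟨e.hom, fun n x => (h n x).1⟩
  inv := ⟨e.inv, fun n y hy => (h n _).2 (by
    have : e.hom.app (op ⦋n⦌) (e.inv.app (op ⦋n⦌) y) = y := by simp
    rwa [this])⟩
  hom_inv_id := hom_ext e.hom_inv_id
  inv_hom_id := hom_ext e.inv_hom_id

instance : MonoidalCategoryStruct Strat.{u} where
  tensorObj := laxTensor
  tensorHom f g := laxTensorHom f g
  whiskerLeft X _ _ g := laxTensorHom (𝟙 X) g
  whiskerRight f Y := laxTensorHom f (𝟙 Y)
  tensorUnit := unit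
  associator X Y Z :=
    isoMk (α_ X.toSSet Y.toSSet Z.toSSet) (fun _ => mem_thin_laxTensor_assoc)
  leftUnitor X := isoMk (λ_ X.toSSet) (fun _ => mem_thin_unit_laxTensor)
  rightUnitor X := isoMk (ρ_ X.toSSet) (fun _ => mem_thin_laxTensor_unit)

/-- The monoidal category `(Strat, ⊗, Δ[0])`: the forgetful functor to simplicial sets with the
cartesian product is strict monoidal. -/
instance : MonoidalCategory Strat.{u} :=
  Monoidal.induced forget
    { μIso := fun _ _ => Iso.refl _
      εIso := Iso.refl _
      whiskerLeft_eq := fun X _ _ f => by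
        show 𝟙 X.toSSet ⊗ₘ Hom.toMap f = 𝟙 _ ≫ (X.toSSet ◁ Hom.toMap f) ≫ 𝟙 _
        simp
      whiskerRight_eq := fun f X => by
        show Hom.toMap f ⊗ₘ 𝟙 X.toSSet = 𝟙 _ ≫ (Hom.toMap f ▷ X.toSSet) ≫ 𝟙 _
        simp
      tensorHom_eq := fun _ _ => rfl
      associator_eq := fun X Y Z => by
        show (α_ X.toSSet Y.toSSet Z.toSSet).hom =
          ((𝟙 _ ≫ (𝟙 _ ⊗ₘ 𝟙 _)) ≫ (α_ X.toSSet Y.toSSet Z.toSSet).hom ≫ ((𝟙 _ ⊗ₘ 𝟙 _) ≫ 𝟙 _))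
        simp
      leftUnitor_eq := fun X => by
        show (λ_ X.toSSet).hom = (𝟙 _ ≫ (𝟙 _ ⊗ₘ 𝟙 _)) ≫ (λ_ X.toSSet).hom
        simp
      rightUnitor_eq := fun X => by
        show (ρ_ X.toSSet).hom = (𝟙 _ ≫ (𝟙 _ ⊗ₘ 𝟙 _)) ≫ (ρ_ X.toSSet).hom
        simp }

end Strat
end StratGray

namespace StratGray

/-! ### Homotopy coherent paths -/

/-- An arrow `r ⟶ s` of the locally ordered category of homotopy coherent paths: a tuple
`(a_s, …, a_{r+1})` of elements of `[1]` with `a_s = 0` if `r < s`. The tuple is recorded as a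
function on `ℕ` which takes the value `1` outside of the index set `(r, s]`. -/
@[ext]
structure PathHom (r s : ℕ) : Type where
  coord : ℕ → Fin 2
  le : r ≤ s
  coord_eq_one : ∀ i, ¬ (r < i ∧ i ≤ s) → coord i = 1
  coord_last : r < s → coord s = 0

namespace PathHom

/-- Tuples are ordered pointwise. -/
instance (r s : ℕ) : PartialOrder (PathHom r s) :=
  PartialOrder.lift coord (fun _ _ h => PathHom.ext h)

theorem le_def {r s : ℕ} (a b : PathHom r s) : a ≤ b ↔ ∀ i, a.coord i ≤ b.coord i := Iff.rfl

/-- The identity is the empty tuple. -/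
def id (r : ℕ) : PathHom r r where
  coord _ := 1
  le := le_rfl
  coord_eq_one _ _ := rfl
  coord_last h := (lt_irrefl r h).elim

/-- Composition is concatenation of tuples; since `a` is `1` outside of `(r, s]` and `b` is `1`
outside of `(s, t]`, the concatenation is the pointwise minimum. -/
def comp {r s t : ℕ} (b : PathHom s t) (a : PathHom r s) : PathHom r t where
  coord i := b.coord i ⊓ a.coord i
  le := a.le.trans b.le
  coord_eq_one i hi := by
    have h1 := a.le
    have h2 := b.le
    rw [b.coord_eq_one i (by omega), a.coord_eq_one i (by omega)]
    rfl
  coord_last h := by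
    rcases b.le.eq_or_lt with rfl | h'
    · rw [a.coord_last h]
      exact min_eq_right (Fin.zero_le _)
    · rw [b.coord_last h']
      exact min_eq_left (Fin.zero_le _)

theorem fin_two_ext {x y : Fin 2} (h : x = 0 ↔ y = 0) : x = y := by
  revert x y; decide

theorem ext_zero {r s : ℕ} {a b : PathHom r s} (h : ∀ i, a.coord i = 0 ↔ b.coord i = 0) :
    a = b :=
  PathHom.ext (funext fun i => fin_two_ext (h i))

theorem le_iff_zero {r s : ℕ} {a b : PathHom r s} :
    a ≤ b ↔ ∀ i, b.coord i = 0 → a.coord i = 0 := by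
  have : ∀ x y : Fin 2, x ≤ y ↔ (y = 0 → x = 0) := by decide
  exact forall_congr' fun i => this _ _

theorem comp_coord_eq_zero {r s t : ℕ} (b : PathHom s t) (a : PathHom r s) (i : ℕ) :
    (comp b a).coord i = 0 ↔ b.coord i = 0 ∨ a.coord i = 0 := by
  have : ∀ x y : Fin 2, x ⊓ y = 0 ↔ x = 0 ∨ y = 0 := by decide
  exact this _ _

theorem mem_of_coord_eq_zero {r s : ℕ} (a : PathHom r s) {i : ℕ} (h : a.coord i = 0) :
    r < i ∧ i ≤ s := by
  by_contra hi
  rw [a.coord_eq_one i hi] at h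
  exact absurd h (by decide)

theorem coord_eq_one_iff {r s : ℕ} (a : PathHom r s) (i : ℕ) :
    a.coord i = 1 ↔ ¬ a.coord i = 0 := by
  have : ∀ x : Fin 2, x = 1 ↔ ¬ x = 0 := by decide
  exact this _

open Classical in
/-- The action of a simplicial operator `α : [n] ⟶ [m]` on arrows: the ordinate at index `j` of
the image of `(a_s, …, a_{r+1})` is the minimum of the ordinates `a_i` with `α(i) = j`, and it is
`1` if there are none. This sends each indecomposable `⟨r, s⟩ = (0, 1, …, 1)` to
`⟨α(r), α(s)⟩`, and it preserves composition. -/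
noncomputable def map {n m : SimplexCategory} (α : n ⟶ m) {r s : Fin (n.len + 1)}
    (a : PathHom r s) : PathHom (α.toOrderHom r) (α.toOrderHom s) where
  coord j :=
    if α.toOrderHom r < j ∧ ∃ i : Fin (n.len + 1), (α.toOrderHom i : ℕ) = j ∧ a.coord i = 0
    then 0 else 1
  le := α.toOrderHom.monotone a.le
  coord_eq_one j hj := by
    rw [if_neg]
    rintro ⟨h1, i, rfl, hi⟩
    exact hj ⟨h1, α.toOrderHom.monotone (a.mem_of_coord_eq_zero hi).2⟩
  coord_last h := by
    rw [if_pos]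
    refine ⟨h, s, rfl, a.coord_last ?_⟩
    by_contra hrs
    exact absurd (α.toOrderHom.monotone (not_lt.1 hrs : s ≤ r)) (not_le.2 h)

theorem map_coord_eq_zero {n m : SimplexCategory} (α : n ⟶ m) {r s : Fin (n.len + 1)}
    (a : PathHom r s) (j : ℕ) :
    (map α a).coord j = 0 ↔ (α.toOrderHom r : ℕ) < j ∧
      ∃ i : Fin (n.len + 1), (α.toOrderHom i : ℕ) = j ∧ a.coord i = 0 := by
  classical
  simp only [map]
  split_ifs with h
  · exact ⟨fun _ => h, fun _ => rfl⟩
  · exact ⟨fun h' => absurd h' (by decide), fun h' => (h h').elim⟩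

theorem map_mono {n m : SimplexCategory} (α : n ⟶ m) {r s : Fin (n.len + 1)} :
    Monotone (map α : PathHom r s → _) := by
  intro a b h
  rw [le_iff_zero] at h ⊢
  intro j hj
  rw [map_coord_eq_zero] at hj ⊢
  obtain ⟨h1, i, h2, h3⟩ := hj
  exact ⟨h1, i, h2, h _ h3⟩

theorem map_id_path {n m : SimplexCategory} (α : n ⟶ m) (r : Fin (n.len + 1)) :
    map α (id (r : ℕ)) = id _ := by
  refine ext_zero fun j => ?_
  rw [map_coord_eq_zero]
  simp [id]

theorem map_comp_path {n m : SimplexCategory} (α : n ⟶ m) {r s t : Fin (n.len + 1)}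
    (b : PathHom s t) (a : PathHom r s) : map α (comp b a) = comp (map α b) (map α a) := by
  refine ext_zero fun j => ?_
  simp only [map_coord_eq_zero, comp_coord_eq_zero]
  constructor
  · rintro ⟨h1, i, rfl, h2 | h2⟩
    · by_cases hs : (α.toOrderHom s : ℕ) < α.toOrderHom i
      · exact Or.inl ⟨hs, i, rfl, h2⟩
      · right
        have hsi : α.toOrderHom s ≤ α.toOrderHom i :=
          α.toOrderHom.monotone (b.mem_of_coord_eq_zero h2).1.le
        have he : (α.toOrderHom s : ℕ) = α.toOrderHom i := le_antisymm hsi (not_lt.1 hs)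
        refine ⟨h1, s, he, a.coord_last ?_⟩
        by_contra hrs
        have := α.toOrderHom.monotone (not_lt.1 hrs : s ≤ r)
        have : (α.toOrderHom s : ℕ) ≤ α.toOrderHom r := this
        omega
    · exact Or.inr ⟨h1, i, rfl, h2⟩
  · rintro (⟨h1, i, h2, h3⟩ | ⟨h1, i, h2, h3⟩)
    · exact ⟨lt_of_le_of_lt (α.toOrderHom.monotone a.le) h1, i, h2, Or.inl h3⟩
    · exact ⟨h1, i, h2, Or.inr h3⟩

theorem id_map {n : SimplexCategory} {r s : Fin (n.len + 1)} (a : PathHom r s) :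
    map (𝟙 n) a = a := by
  refine ext_zero fun j => ?_
  rw [map_coord_eq_zero]
  constructor
  · rintro ⟨-, i, rfl, h⟩
    exact h
  · intro h
    have hj := a.mem_of_coord_eq_zero h
    exact ⟨hj.1, ⟨j, by omega⟩, rfl, h⟩

theorem comp_map {n m k : SimplexCategory} (α : n ⟶ m) (β : m ⟶ k) {r s : Fin (n.len + 1)}
    (a : PathHom r s) : map (α ≫ β) a = map β (map α a) := by
  refine ext_zero fun j => ?_
  erw [map_coord_eq_zero, map_coord_eq_zero]
  constructor
  · rintro ⟨h1, i, h2, h3⟩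
    refine ⟨h1, α.toOrderHom i, h2, (map_coord_eq_zero _ _ _).2 ⟨?_, i, rfl, h3⟩⟩
    by_contra hlt
    have : (β.toOrderHom (α.toOrderHom i) : ℕ) ≤ β.toOrderHom (α.toOrderHom r) :=
      β.toOrderHom.monotone (not_lt.1 hlt : α.toOrderHom i ≤ α.toOrderHom r)
    have h1' : (β.toOrderHom (α.toOrderHom r) : ℕ) < j := h1
    have h2' : (β.toOrderHom (α.toOrderHom i) : ℕ) = j := h2
    omega
  · rintro ⟨h1, k, h2, h3⟩
    obtain ⟨-, i, h5, h6⟩ := (map_coord_eq_zero _ _ _).1 h3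
    have : k = α.toOrderHom i := Fin.ext h5.symm
    subst this
    exact ⟨h1, i, h2, h6⟩

end PathHom

/-- The simplicial set of arrows `r ⟶ s` in the simplicially enriched category of homotopy
coherent paths: the categorical nerve of the ordered set of tuples. -/
abbrev pathSSet (r s : ℕ) : SSet.{u} := nerve (ULift.{u} (PathHom r s))

/-- The `i`-th ordinate of a simplex of tuples, as a simplex of `Δ[1]`. -/
def ordinate (r s i : ℕ) : pathSSet.{u} r s ⟶ Δ[1] where
  app _ := ↾fun x => SSet.stdSimplex.objMk
    ⟨fun v => (x.obj v).down.coord i, fun _ _ h => x.monotone h i⟩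
  naturality _ _ _ := rfl

/-- The `k`-fold tensor power of `Δ[1]` (minimally stratified). -/
def cube (k : ℕ) : Strat.{u} :=
  match k with
  | 0 => 𝟙_ Strat.{u}
  | k + 1 => Strat.minimal Δ[1] ⊗ cube k

/-- The simplicial map `(α_s, …, α_{r+1}) ↦ (α_{r+k}, …, α_{r+1})` from the simplicial set of
tuples to the simplicial set underlying the `k`-fold tensor power of `Δ[1]`. -/
def toCube (r s k : ℕ) : pathSSet.{u} r s ⟶ (cube.{u} k).toSSet :=
  match k with
  | 0 => CartesianMonoidalCategory.toUnit (pathSSet.{u} r s)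
  | k + 1 => CartesianMonoidalCategory.lift (ordinate r s (r + k + 1)) (toCube r s k)

/-- The stratified set of arrows `r ⟶ s` of homotopy coherent paths, as a regular subset of the
`(s - r)`-fold tensor power of `Δ[1]`. -/
def pathStrat (r s : ℕ) : Strat.{u} := Strat.induced (toCube.{u} r s (s - r))

end StratGray

namespace StratGray

theorem interval_notMem_thin {m : ℕ} (x : (Δ[1] : SSet.{u}) _⦋m⦌) :
    x ∉ (Strat.minimal.{u} Δ[1]).thin m ↔
      m ≤ 1 ∧ ∀ (h : 1 ≤ m), x ⟨0, by omega⟩ = 0 ∧ x ⟨1, by omega⟩ = 1 := by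
  show x ∈ SSet.nonDegenerate _ m ↔ _
  rw [SSet.stdSimplex.mem_nonDegenerate_iff_strictMono]
  constructor
  · intro hx
    have hm : m ≤ 1 := by
      have := Fintype.card_le_of_injective _ hx.injective
      simpa using this
    refine ⟨hm, fun h => ?_⟩
    have : ∀ a b : Fin 2, a < b → a = 0 ∧ b = 1 := by decide
    exact this _ _ (hx (Fin.mk_lt_mk.2 Nat.zero_lt_one))
  · rintro ⟨hm, h⟩ ⟨i, hi⟩ ⟨j, hj⟩ hij
    have hij' : i < j := hij
    obtain ⟨rfl, rfl⟩ : i = 0 ∧ j = 1 := by omega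
    have := h (by omega)
    show x _ < x _
    rw [this.1, this.2]
    decide

/-- A simplex of tuples is non-thin iff it jumps, at its successive steps, at a strictly
decreasing sequence of ordinates. -/
theorem toCube_notMem_thin (r s k : ℕ) : ∀ {m : ℕ} (x : (pathSSet.{u} r s) _⦋m⦌),
    (toCube.{u} r s k).app (op ⦋m⦌) x ∉ (cube.{u} k).thin m ↔
      ∃ f : ℕ → ℕ, (∀ l l', l < l' → l' < m → f l' < f l) ∧
        ∀ (l : ℕ) (h : l < m), r < f l ∧ f l ≤ r + k ∧
          (x.obj ⟨l, by simp; omega⟩).down.coord (f l) = 0 ∧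
          (x.obj ⟨l + 1, by simp; omega⟩).down.coord (f l) = 1 := by
  induction k with
  | zero =>
    intro m x
    have : (toCube.{u} r s 0).app (op ⦋m⦌) x ∈ (cube.{u} 0).thin m ↔ 0 < m :=
      Strat.mem_degenerate_unit _
    rw [this]
    constructor
    · intro h
      exact ⟨fun _ => 0, fun l l' _ h' => by omega, fun l h' => by omega⟩
    · rintro ⟨f, -, hf⟩ h
      have := hf 0 h
      omega
  | succ k ih =>
    intro m x
    have h0 : (toCube.{u} r s (k + 1)).app (op ⦋m⦌) x ∉ (cube.{u} (k + 1)).thin m ↔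
        ∃ (p q : ℕ) (h : p + q = m),
          (ordinate r s (r + k + 1)).app (op ⦋p⦌)
            ((pathSSet.{u} r s).map (SimplexCategory.subinterval 0 p (by omega)).op x) ∉
            (Strat.minimal.{u} Δ[1]).thin p ∧
          (toCube.{u} r s k).app (op ⦋q⦌)
            ((pathSSet.{u} r s).map (SimplexCategory.subinterval p q (by omega)).op x) ∉
            (cube.{u} k).thin q := by
      rw [← not_iff_not]
      push Not
      refine Iff.trans (Strat.mem_thin_laxTensor _) ?_
      refine forall_congr' fun p => forall_congr' fun q => forall_congr' fun h => ?_
      rw [NatTrans.naturality_apply, NatTrans.naturality_apply]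
      exact or_iff_not_imp_left
    rw [h0]
    constructor
    · rintro ⟨p, q, rfl, h1, h2⟩
      rw [interval_notMem_thin] at h1
      rw [ih] at h2
      obtain ⟨hp, h1⟩ := h1
      obtain ⟨f, hf, h2⟩ := h2
      refine ⟨fun l => if l < p then r + k + 1 else f (l - p), ?_, ?_⟩
      · intro l l' hl hl'
        have : ¬ l' < p → f (l' - p) ≤ r + k := fun h => (h2 (l' - p) (by omega)).2.1
        have := hf (l - p) (l' - p)
        dsimp only
        split_ifs <;> omega
      · intro l hl
        dsimp only
        split_ifs with hlp
        · obtain rfl : l = 0 := by omega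
          obtain rfl : p = 1 := by omega
          exact ⟨by omega, by omega, h1 le_rfl⟩
        · obtain ⟨l, rfl⟩ := Nat.exists_eq_add_of_le' (not_lt.1 hlp)
          have h3 := h2 l (by omega)
          simp only [Nat.add_sub_cancel]
          refine ⟨h3.1, by omega, h3.2.2.1, ?_⟩
          have h4 := h3.2.2.2
          have e : l + 1 + p = l + p + 1 := by omega
          refine Eq.trans ?_ h4
          refine congrArg (fun v => (x.obj v).down.coord (f l)) (Fin.ext e.symm)
    · rintro ⟨f, hf, h2⟩
      by_cases hm : 0 < m ∧ f 0 = r + k + 1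
      · obtain ⟨hm, hf0⟩ := hm
        obtain ⟨q, rfl⟩ := Nat.exists_eq_add_of_le (show 1 ≤ m from hm)
        refine ⟨1, q, rfl, ?_, ?_⟩
        · rw [interval_notMem_thin]
          refine ⟨le_rfl, fun _ => ?_⟩
          have := (h2 0 hm).2.2
          rw [hf0] at this
          exact this
        · rw [ih]
          refine ⟨fun l => f (l + 1), fun l l' h h' => hf _ _ (by omega) (by omega), ?_⟩
          intro l hl
          have h3 := h2 (l + 1) (by omega)
          have := hf 0 (l + 1) (by omega) (by omega)
          exact ⟨h3.1, show f (l + 1) ≤ r + k by omega, h3.2.2⟩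
      · refine ⟨0, m, by omega, ?_, ?_⟩
        · rw [interval_notMem_thin]
          exact ⟨by omega, fun h => by omega⟩
        · rw [ih]
          refine ⟨f, hf, fun l hl => ?_⟩
          have h3 := h2 l hl
          refine ⟨h3.1, ?_, h3.2.2⟩
          rcases Nat.eq_zero_or_pos l with rfl | hl0
          · have : f 0 ≠ r + k + 1 := fun h => hm ⟨hl, h⟩
            omega
          · have := hf 0 l hl0 hl
            have := (h2 0 (by omega)).2.1
            omega

theorem pathStrat_notMem_thin {r s m : ℕ} (x : (pathSSet.{u} r s) _⦋m⦌) :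
    x ∉ (pathStrat.{u} r s).thin m ↔
      ∃ f : ℕ → ℕ, (∀ l l', l < l' → l' < m → f l' < f l) ∧
        ∀ (l : ℕ) (h : l < m),
          (x.obj ⟨l, by simp; omega⟩).down.coord (f l) = 0 ∧
          (x.obj ⟨l + 1, by simp; omega⟩).down.coord
            (f l) = 1 := by
  refine (toCube_notMem_thin.{u} r s (s - r) x).trans ?_
  refine exists_congr fun f => and_congr_right fun _ => forall_congr' fun l =>
    forall_congr' fun h => ⟨fun h' => h'.2.2, fun h' => ?_⟩
  have := PathHom.mem_of_coord_eq_zero _ h'.1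
  exact ⟨by omega, by omega, h'⟩

/-- Composition `S(s, t) ⊗ S(r, s) ⟶ S(r, t)` of homotopy coherent paths: pointwise
concatenation of tuples. -/
def pathCompMap (r s t : ℕ) : pathSSet.{u} s t ⊗ pathSSet.{u} r s ⟶ pathSSet.{u} r t where
  app _ := ↾fun x => Monotone.functor
    (f := fun v => ULift.up (PathHom.comp (x.1.obj v).down (x.2.obj v).down))
    (fun _ _ h i => min_le_min (x.1.monotone h i) (x.2.monotone h i))
  naturality _ _ _ := rfl

/-- The composition is stratified. -/
def pathComp (r s t : ℕ) : pathStrat.{u} s t ⊗ pathStrat.{u} r s ⟶ pathStrat.{u} r t where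
  toMap := pathCompMap r s t
  map_thin m z hz := by
    obtain ⟨b, a⟩ := z
    change (pathSSet.{u} s t) _⦋m⦌ at b
    change (pathSSet.{u} r s) _⦋m⦌ at a
    by_contra hcon
    obtain ⟨f, hf, h⟩ := (pathStrat_notMem_thin _).1 hcon
    have h0 : ∀ (l : ℕ) (hl : l < m),
        (b.obj ⟨l, by simp; omega⟩).down.coord (f l) = 0 ∨
          (a.obj ⟨l, by simp; omega⟩).down.coord (f l) = 0 := fun l hl =>
      (PathHom.comp_coord_eq_zero _ _ _).1 (h l hl).1
    have h1 : ∀ (l : ℕ) (hl : l < m),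
        (b.obj ⟨l + 1, by simp; omega⟩).down.coord (f l) = 1 ∧
          (a.obj ⟨l + 1, by simp; omega⟩).down.coord (f l) = 1 := fun l hl => by
      have := ((PathHom.coord_eq_one_iff _ _).1 (h l hl).2)
      have h' := not_or.1 fun h'' => this ((PathHom.comp_coord_eq_zero _ _ _).2 h'')
      exact ⟨(PathHom.coord_eq_one_iff _ _).2 h'.1, (PathHom.coord_eq_one_iff _ _).2 h'.2⟩
    classical
    have hex : ∃ p, m ≤ p ∨ f p ≤ s := ⟨m, Or.inl le_rfl⟩
    obtain ⟨p, hp, hmin⟩ : ∃ p, (m ≤ p ∨ f p ≤ s) ∧ ∀ l < p, ¬ (m ≤ l ∨ f l ≤ s) :=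
      ⟨Nat.find hex, Nat.find_spec hex, fun l hl => Nat.find_min hex hl⟩
    have hpm : p ≤ m := by
      by_contra hlt
      exact hmin m (by omega) (Or.inl le_rfl)
    obtain ⟨q, rfl⟩ := Nat.exists_eq_add_of_le hpm
    rcases hz p q rfl with h2 | h2
    · refine (pathStrat_notMem_thin _).2 ?_ h2
      refine ⟨f, fun l l' hl hl' => hf l l' hl (by omega), fun l hl => ?_⟩
      refine ⟨(h0 l (by omega)).resolve_right fun h3 => ?_, (h1 l (by omega)).1⟩
      have := PathHom.mem_of_coord_eq_zero _ h3
      exact hmin l hl (Or.inr this.2)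
    · refine (pathStrat_notMem_thin _).2 ?_ h2
      refine ⟨fun l => f (l + p), fun l l' hl hl' => hf _ _ (by omega) (by omega),
        fun l hl => ?_⟩
      refine ⟨(h0 (l + p) (by omega)).resolve_left fun h3 => ?_, ?_⟩
      · have := PathHom.mem_of_coord_eq_zero _ h3
        rcases Nat.eq_zero_or_pos l with rfl | hl0
        · rw [zero_add] at this
          omega
        · have := hf p (l + p) (by omega) (by omega)
          omega
      · refine Eq.trans ?_ (h1 (l + p) (by omega)).2
        exact congrArg (fun v => (a.obj v).down.coord (f (l + p)))
          (Fin.ext (show l + 1 + p = l + p + 1 by omega))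

/-- The identity arrow at `r`. -/
def pathId (r : ℕ) : 𝟙_ Strat.{u} ⟶ pathStrat.{u} r r where
  toMap :=
    { app := fun _ => ↾fun _ => Monotone.functor (f := fun _ => ULift.up (PathHom.id r))
        (fun _ _ _ => le_rfl)
      naturality := fun _ _ _ => rfl }
  map_thin _ _ hx := (pathStrat r r).degenerate_subset _ (SSet.degenerate_app_apply hx _)

/-- The action of a simplicial operator on the stratified sets of arrows. -/
noncomputable def pathMap {n m : SimplexCategory} (α : n ⟶ m) (r s : Fin (n.len + 1)) :
    pathStrat.{u} r s ⟶ pathStrat.{u} (α.toOrderHom r) (α.toOrderHom s) where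
  toMap := nerveMap (Monotone.functor (f := fun a => ULift.up (PathHom.map α a.down))
    (fun _ _ h => PathHom.map_mono α h))
  map_thin k x hx := by
    change (pathSSet.{u} r s) _⦋k⦌ at x
    by_contra hcon
    obtain ⟨f, hf, h⟩ := (pathStrat_notMem_thin _).1 hcon
    refine (pathStrat_notMem_thin _).2 ?_ hx
    have h0 : ∀ (l : ℕ) (hl : l < k), ∃ i : Fin (n.len + 1),
        (α.toOrderHom i : ℕ) = f l ∧ (x.obj ⟨l, by simp; omega⟩).down.coord i = 0 ∧
          (x.obj ⟨l + 1, by simp; omega⟩).down.coord i = 1 := fun l hl => by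
      obtain ⟨h1, i, h2, h3⟩ := (PathHom.map_coord_eq_zero α _ _).1 (h l hl).1
      refine ⟨i, h2, h3, (PathHom.coord_eq_one_iff _ _).2 fun h4 => ?_⟩
      exact (PathHom.coord_eq_one_iff _ _).1 (h l hl).2
        ((PathHom.map_coord_eq_zero α _ _).2 ⟨h1, i, h2, h4⟩)
    choose! g hg using h0
    refine ⟨fun l => g l, fun l l' hl hl' => ?_, fun l hl => (hg l hl).2⟩
    by_contra hlt
    have h1 : α.toOrderHom (g l) ≤ α.toOrderHom (g l') := α.toOrderHom.monotone (not_lt.1 hlt)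
    have h2 : (α.toOrderHom (g l) : ℕ) ≤ α.toOrderHom (g l') := h1
    rw [(hg l (by omega)).1, (hg l' hl').1] at h2
    have := hf l l' hl hl'
    omega

theorem PathHom.comp_id {r s : ℕ} (a : PathHom r s) : comp a (id r) = a := by
  refine ext_zero fun i => ?_
  rw [comp_coord_eq_zero]
  simp [id]

theorem PathHom.id_comp {r s : ℕ} (a : PathHom r s) : comp (id s) a = a := by
  refine ext_zero fun i => ?_
  rw [comp_coord_eq_zero]
  simp [id]

theorem PathHom.comp_assoc {q r s t : ℕ} (c : PathHom s t) (b : PathHom r s) (a : PathHom q r) :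
    comp (comp c b) a = comp c (comp b a) := by
  refine ext_zero fun i => ?_
  simp only [comp_coord_eq_zero, or_assoc]

theorem pathStrat_hom_ext {X : Strat.{u}} {r s : ℕ} {f g : X ⟶ pathStrat.{u} r s}
    (h : ∀ (m : SimplexCategoryᵒᵖ) (x : X.toSSet.obj m) (v : Fin (m.unop.len + 1)),
      ((Strat.Hom.toMap f).app m x : (pathSSet.{u} r s).obj m).obj v =
        ((Strat.Hom.toMap g).app m x : (pathSSet.{u} r s).obj m).obj v) : f = g := by
  refine Strat.hom_ext ?_
  ext m x
  exact nerve.ext_of_isThin (funext fun v => h m x v)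

/-- The objects of the generic homotopy coherent `n`-path: the elements of the ordinal `[n]`. -/
def PathObj (n : SimplexCategory) : Type := Fin (n.len + 1)

/-- The underlying natural number of an object. -/
def PathObj.val {n : SimplexCategory} (r : PathObj n) : ℕ := Fin.val (n := n.len + 1) r

/-- The generic homotopy coherent `n`-path as a category enriched in stratified sets for the lax
Gray tensor product. The composition is a map `S(s, t) ⊗ S(r, s) ⟶ S(r, t)`; since enriched
categories in Mathlib compose in the order `Hom(r, s) ⊗ Hom(s, t)`, they are taken over the monoidal
opposite of `(Strat, ⊗, Δ[0])`. -/
instance (n : SimplexCategory) : EnrichedCategory Strat.{u}ᴹᵒᵖ (PathObj n) where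
  Hom r s := .mop (pathStrat.{u} r.val s.val)
  id r := (pathId r.val).mop
  comp r s t := (pathComp r.val s.val t.val).mop
  id_comp _ _ := MonoidalOpposite.hom_ext (pathStrat_hom_ext fun _ _ _ =>
    congrArg ULift.up (PathHom.comp_id _))
  comp_id _ _ := MonoidalOpposite.hom_ext (pathStrat_hom_ext fun _ _ _ =>
    congrArg ULift.up (PathHom.id_comp _))
  assoc _ _ _ _ := MonoidalOpposite.hom_ext (pathStrat_hom_ext fun _ _ _ =>
    congrArg ULift.up (PathHom.comp_assoc _ _ _).symm)

/-- The enriched functor between generic homotopy coherent paths induced by a simplicial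
operator. -/
noncomputable def pathFunctor {n m : SimplexCategory} (α : n ⟶ m) :
    EnrichedFunctor Strat.{u}ᴹᵒᵖ (PathObj n) (PathObj m) where
  obj r := α.toOrderHom r
  map r s := (pathMap.{u} α r s).mop
  map_id _ := MonoidalOpposite.hom_ext (pathStrat_hom_ext fun _ _ _ =>
    congrArg ULift.up (PathHom.map_id_path α _))
  map_comp _ _ _ := MonoidalOpposite.hom_ext (pathStrat_hom_ext fun _ _ _ =>
    congrArg ULift.up (PathHom.map_comp_path α _ _))

section

variable {V : Type*} [Category* V] [MonoidalCategory V]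
  {C : Type*} [EnrichedCategory V C] {D : Type*} [EnrichedCategory V D]
  {E : Type*} [EnrichedCategory V E] {E' : Type*} [EnrichedCategory V E']

theorem enrichedFunctor_ext (obj : C → D) {f g : ∀ X Y : C, (X ⟶[V] Y) ⟶ obj X ⟶[V] obj Y}
    {h₁ h₂ h₃ h₄} (h : ∀ X Y, f X Y = g X Y) :
    (⟨obj, f, h₁, h₂⟩ : EnrichedFunctor V C D) = ⟨obj, g, h₃, h₄⟩ := by
  obtain rfl : f = g := funext fun X => funext fun Y => h X Y
  rfl

theorem enrichedFunctor_id_comp (F : EnrichedFunctor V C D) :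
    (EnrichedFunctor.id V C).comp V F = F :=
  enrichedFunctor_ext _ fun _ _ => Category.id_comp _

theorem enrichedFunctor_comp_id (F : EnrichedFunctor V C D) :
    F.comp V (EnrichedFunctor.id V D) = F :=
  enrichedFunctor_ext _ fun _ _ => Category.comp_id _

theorem enrichedFunctor_assoc (F : EnrichedFunctor V C D) (G : EnrichedFunctor V D E)
    (H : EnrichedFunctor V E E') : (F.comp V G).comp V H = F.comp V (G.comp V H) :=
  enrichedFunctor_ext _ fun _ _ => Category.assoc _ _ _

end

theorem pathFunctor_id (n : SimplexCategory) :
    pathFunctor.{u} (𝟙 n) = EnrichedFunctor.id _ (PathObj n) :=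
  enrichedFunctor_ext _ fun _ _ => MonoidalOpposite.hom_ext (pathStrat_hom_ext fun _ _ _ =>
    congrArg ULift.up (PathHom.id_map _))

theorem pathFunctor_comp {n m k : SimplexCategory} (α : n ⟶ m) (β : m ⟶ k) :
    pathFunctor.{u} (α ≫ β) = (pathFunctor.{u} α).comp _ (pathFunctor.{u} β) :=
  enrichedFunctor_ext _ fun _ _ => MonoidalOpposite.hom_ext (pathStrat_hom_ext fun _ _ _ =>
    congrArg ULift.up (PathHom.comp_map α β _))

/-! ### The nerve of a category enriched in stratified sets -/

/-- A category enriched in `(Strat, ⊗, Δ[0])`, with composition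
`E(b, c) ⊗ E(a, b) ⟶ E(a, c)`. -/
structure StratCat : Type (max (u + 1) (w + 1)) where
  carrier : Type w
  str : EnrichedCategory Strat.{u}ᴹᵒᵖ carrier

attribute [instance] StratCat.str

/-- The category of categories enriched in `(Strat, ⊗, Δ[0])` and enriched functors. -/
instance : Category StratCat.{u, w} where
  Hom C D := EnrichedFunctor Strat.{u}ᴹᵒᵖ C.carrier D.carrier
  id C := EnrichedFunctor.id _ C.carrier
  comp F G := F.comp _ G
  id_comp := enrichedFunctor_id_comp
  comp_id := enrichedFunctor_comp_id
  assoc := enrichedFunctor_assoc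

/-- The nerve functor: the `n`-simplices of the nerve of `E` are the enriched functors from the
generic homotopy coherent `n`-path to `E`. -/
noncomputable def stratNerve : StratCat.{u, w} ⥤ SSet.{max u w} where
  obj E :=
    { obj := fun n => EnrichedFunctor Strat.{u}ᴹᵒᵖ (PathObj n.unop) E.carrier
      map := fun α => ↾fun F => (pathFunctor.{u} α.unop).comp _ F
      map_id := fun n => by
        ext F
        exact (congrArg (fun G => G.comp _ F) (pathFunctor_id n.unop)).trans
          (enrichedFunctor_id_comp F)
      map_comp := fun α β => by
        ext F
        exact (congrArg (fun G => G.comp _ F) (pathFunctor_comp β.unop α.unop)).trans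
          (enrichedFunctor_assoc _ _ F) }
  map G :=
    { app := fun _ => ↾fun F => F.comp _ G
      naturality := fun _ _ α => by
        ext F
        exact enrichedFunctor_assoc (pathFunctor α.unop) F G }
  map_id E := by
    ext n F
    exact enrichedFunctor_comp_id F
  map_comp G H := by
    ext n F
    exact (enrichedFunctor_assoc F G H).symm

end StratGray

/-!
An enriched functor is determined by its action on objects, which the nerve sees through constant
paths, and by its action on the simplices of the homs.

An arrow `r ⟶ s` of the generic path visits `r` and the indices at which its tuple vanishes, hence
also `s`. For `r ≤ n < s`, the last index `≤ n` which it visits is unaffected by precomposition with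
an arrow ending at most at `n` and by postcomposition with an arrow starting beyond `n`. This
collapses the arrows `r ⟶ s` to `Δ[n]`, so an `n`-simplex `y` of a hom `C(X, Y)` extends to an
enriched functor sending the objects `≤ n` to `X` and the others to `Y`. The collapse of the arrows
`0 ⟶ n + 1` has a section, so `y` is recovered from this functor.

The lax Gray tensor product enters in that the collapse is stratified: a simplex of tuples is not
thin when it jumps at strictly decreasing indices, and along a simplex with nondegenerate image the
last visited index is strictly decreasing.
-/

namespace StratGray

open SemiCartesianMonoidalCategory

section Semicartesian

variable {V : Type*} [Category* V] [SemiCartesianMonoidalCategory V]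

instance : SemiCartesianMonoidalCategory Vᴹᵒᵖ where
  isTerminalTensorUnit := Limits.IsTerminal.ofUniqueHom (fun X => (toUnit X.unmop).mop)
    fun _ _ => MonoidalOpposite.hom_ext (toUnit_unique _ _)
  fst X Y := (snd Y.unmop X.unmop).mop
  snd X Y := (fst Y.unmop X.unmop).mop
  fst_def _ _ := MonoidalOpposite.hom_ext (snd_def _ _)
  snd_def _ _ := MonoidalOpposite.hom_ext (fst_def _ _)

variable {C : Type*} [EnrichedCategory V C] {D : Type*} [EnrichedCategory V D]

theorem toUnit_eId_tensorHom_eComp {X Y : D} {A B : V} (g : B ⟶ (X ⟶[V] Y)) :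
    ((toUnit A ≫ eId V X) ⊗ₘ g) ≫ eComp V X X Y = snd A B ≫ g := by
  have eId_comp : eId V X ▷ (X ⟶[V] Y) ≫ eComp V X X Y = (λ_ _).hom := by
    rw [← cancel_epi (λ_ (X ⟶[V] Y)).inv, e_id_comp, Iso.inv_hom_id]
  have snd_eq : snd A B = toUnit A ▷ B ≫ (λ_ B).hom := snd_def A B
  rw [snd_eq, MonoidalCategory.tensorHom_def', comp_whiskerRight, Category.assoc, Category.assoc,
    eId_comp, Category.assoc, ← leftUnitor_naturality, whisker_exchange_assoc]

theorem tensorHom_toUnit_eId_eComp {X Y : D} {A B : V} (g : A ⟶ (X ⟶[V] Y)) :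
    (g ⊗ₘ (toUnit B ≫ eId V Y)) ≫ eComp V X Y Y = fst A B ≫ g := by
  have comp_eId : (X ⟶[V] Y) ◁ eId V Y ≫ eComp V X Y Y = (ρ_ _).hom := by
    rw [← cancel_epi (ρ_ (X ⟶[V] Y)).inv, e_comp_id, Iso.inv_hom_id]
  have fst_eq : fst A B = A ◁ toUnit B ≫ (ρ_ A).hom := fst_def A B
  rw [fst_eq, MonoidalCategory.tensorHom_def, MonoidalCategory.whiskerLeft_comp, Category.assoc,
    Category.assoc, comp_eId, Category.assoc, ← rightUnitor_naturality, ← whisker_exchange_assoc]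

variable (V C) in
/-- The enriched functor with constant value `X`. It exists because the unit of `V` is terminal. -/
def constEnrichedFunctor (X : D) : EnrichedFunctor V C D where
  obj _ := X
  map _ _ := toUnit _ ≫ eId V X
  map_id _ := by
    rw [comp_toUnit_assoc, toUnit_unit, Category.id_comp]
  map_comp _ _ _ := by
    rw [toUnit_eId_tensorHom_eComp, comp_toUnit_assoc, comp_toUnit_assoc]

end Semicartesian

theorem comp_map_eq_of_comp_eq {V : Type*} [Category* V] [MonoidalCategory V]
    {C : Type*} [EnrichedCategory V C] {D : Type*} [EnrichedCategory V D]
    {E : Type*} [EnrichedCategory V E] (P : EnrichedFunctor V C D) {obj : D → E}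
    {f g : ∀ X Y : D, (X ⟶[V] Y) ⟶ obj X ⟶[V] obj Y} {h₁ h₂ h₃ h₄}
    (h : P.comp V ⟨obj, f, h₁, h₂⟩ = P.comp V ⟨obj, g, h₃, h₄⟩) (X Y : C) :
    P.map X Y ≫ f _ _ = P.map X Y ≫ g _ _ := by
  simp only [EnrichedFunctor.comp, EnrichedFunctor.mk.injEq, heq_eq_eq, true_and] at h
  exact congrFun₂ h X Y

namespace Strat

instance : SemiCartesianMonoidalCategory Strat.{u} :=
  let isTerminalUnit : Limits.IsTerminal (𝟙_ Strat.{u}) := Limits.IsTerminal.ofUniqueHom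
    (fun X =>
      { toMap := CartesianMonoidalCategory.toUnit X.toSSet
        map_thin := fun n x hx => (mem_degenerate_unit _).2 (Nat.pos_of_ne_zero (by
          rintro rfl
          simp [X.thin_zero] at hx)) })
    fun _ _ => hom_ext (CartesianMonoidalCategory.toUnit_unique _ _)
  { isTerminalTensorUnit := isTerminalUnit
    fst := fun X Y => X ◁ isTerminalUnit.from Y ≫ (ρ_ X).hom
    snd := fun X Y => isTerminalUnit.from X ▷ Y ≫ (λ_ Y).hom
    fst_def := fun _ _ => rfl
    snd_def := fun _ _ => rfl }

/-- A stratified set without simplices is initial. -/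
def isInitialOfIsEmpty {X : Strat.{u}} (h : ∀ m, IsEmpty (X.toSSet.obj m)) :
    Limits.IsInitial X :=
  Limits.IsInitial.ofUniqueHom
    (fun Y =>
      { toMap :=
          { app := fun m => ↾fun x => (h m).elim x
            naturality := fun m _ _ => by
              ext x
              exact (h m).elim x }
        map_thin := fun n x => (h (op ⦋n⦌)).elim x })
    fun _ _ => hom_ext (by
      ext m x
      exact (h m).elim x)

/-- The stratified map out of the minimally stratified `Δ[n]` classifying an `n`-simplex. -/
def ofSimplex {X : Strat.{u}} {n : ℕ} (x : X.toSSet _⦋n⦌) : minimal (Δ[n] : SSet.{u}) ⟶ X where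
  toMap := SSet.yonedaEquiv.symm x
  map_thin m _ hy := X.degenerate_subset m (SSet.degenerate_app_apply hy _)

theorem hom_ext_of_ofSimplex {X Y : Strat.{u}} {f g : X ⟶ Y}
    (h : ∀ (n : ℕ) (x : X.toSSet _⦋n⦌), ofSimplex x ≫ f = ofSimplex x ≫ g) : f = g := by
  refine hom_ext ?_
  ext m x
  induction m using Opposite.rec with | _ m
  induction m using SimplexCategory.rec with | _ n
  have hx := congrArg (fun k => SSet.yonedaEquiv (Hom.toMap k)) (h n x)
  have yonedaEquiv_comp (k : X ⟶ Y) :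
      SSet.yonedaEquiv (Hom.toMap (ofSimplex x ≫ k)) = (Hom.toMap k).app _ x :=
    congrArg ((Hom.toMap k).app _) (SSet.yonedaEquiv.apply_symm_apply x)
  exact (yonedaEquiv_comp f).symm.trans (hx.trans (yonedaEquiv_comp g))

theorem hom_ext_of_stdSimplex {X : Strat.{u}} {n : ℕ} {f g : X ⟶ minimal (Δ[n] : SSet.{u})}
    (h : ∀ (m : ℕ) (x : X.toSSet _⦋m⦌) (v : Fin (m + 1)),
      (show (Δ[n] : SSet.{u}) _⦋m⦌ from (Hom.toMap f).app _ x) v =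
        (show (Δ[n] : SSet.{u}) _⦋m⦌ from (Hom.toMap g).app _ x) v) : f = g := by
  refine hom_ext ?_
  ext m x
  induction m using Opposite.rec with | _ m
  induction m using SimplexCategory.rec with | _ m
  exact SSet.stdSimplex.ext _ _ (h m x)

end Strat

namespace PathHom

variable {r s t : ℕ}

/-- The set of indices visited by an arrow `r ⟶ s`: its source and the indices of its zero
ordinates. Composition of arrows is the union of these sets. -/
def vertices (a : PathHom r s) : Set ℕ := {i | i = r ∨ a.coord i = 0}

instance (a : PathHom r s) : DecidablePred (· ∈ a.vertices) :=
  fun i => inferInstanceAs (Decidable (i = r ∨ a.coord i = 0))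

theorem source_mem_vertices (a : PathHom r s) : r ∈ a.vertices := Or.inl rfl

theorem target_mem_vertices (a : PathHom r s) : s ∈ a.vertices :=
  a.le.eq_or_lt.imp Eq.symm a.coord_last

theorem mem_Icc_of_mem_vertices (a : PathHom r s) {i : ℕ} (hi : i ∈ a.vertices) :
    i ∈ Set.Icc r s := by
  rcases hi with rfl | hi
  · exact ⟨le_rfl, a.le⟩
  · exact (a.mem_of_coord_eq_zero hi).imp_left le_of_lt

theorem vertices_anti {a b : PathHom r s} (h : a ≤ b) : b.vertices ⊆ a.vertices :=
  fun i => Or.imp_right (le_iff_zero.1 h i)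

theorem vertices_comp (b : PathHom s t) (a : PathHom r s) :
    (comp b a).vertices = b.vertices ∪ a.vertices := by
  ext i
  have eq_target : i = s → i ∈ a.vertices := fun h => h ▸ a.target_mem_vertices
  simp only [vertices, Set.mem_union, Set.mem_ofPred_eq, comp_coord_eq_zero] at eq_target ⊢
  tauto

/-- The last index `≤ n` visited by an arrow `r ⟶ s`, or the junk value `0` if `n < r`. -/
def lastVertex (n : ℕ) (a : PathHom r s) : ℕ := Nat.findGreatest (· ∈ a.vertices) n

theorem lastVertex_le (n : ℕ) (a : PathHom r s) : a.lastVertex n ≤ n := Nat.findGreatest_le n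

theorem le_lastVertex {n i : ℕ} {a : PathHom r s} (hin : i ≤ n) (hi : i ∈ a.vertices) :
    i ≤ a.lastVertex n :=
  Nat.le_findGreatest hin hi

theorem lastVertex_mem_vertices {n : ℕ} (hr : r ≤ n) (a : PathHom r s) :
    a.lastVertex n ∈ a.vertices :=
  Nat.findGreatest_spec (P := (· ∈ a.vertices)) hr a.source_mem_vertices

theorem lastVertex_anti (n : ℕ) {a b : PathHom r s} (h : a ≤ b) :
    b.lastVertex n ≤ a.lastVertex n :=
  Nat.findGreatest_mono_left (fun _ hi => vertices_anti h hi) n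

theorem coord_lastVertex {n : ℕ} {a b : PathHom r s} (h : b.lastVertex n < a.lastVertex n) :
    a.coord (a.lastVertex n) = 0 ∧ b.coord (a.lastVertex n) = 1 := by
  have ha : a.lastVertex n ∈ a.vertices :=
    Nat.findGreatest_of_ne_zero (P := (· ∈ a.vertices)) rfl (Nat.ne_zero_of_lt h)
  have hb : a.lastVertex n ∉ b.vertices := fun hb =>
    h.not_ge (le_lastVertex (a.lastVertex_le n) hb)
  obtain ⟨hr, hb⟩ := not_or.1 hb
  exact ⟨ha.resolve_left hr, (coord_eq_one_iff _ _).2 hb⟩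

theorem lastVertex_comp_of_le {n : ℕ} (hs : s ≤ n) (b : PathHom s t) (a : PathHom r s) :
    (comp b a).lastVertex n = b.lastVertex n := by
  have hmem := lastVertex_mem_vertices (a.le.trans hs) (comp b a)
  rw [vertices_comp] at hmem
  refine le_antisymm ?_ (le_lastVertex (b.lastVertex_le n) ?_)
  · rcases hmem with hb | ha
    · exact le_lastVertex (lastVertex_le n _) hb
    · exact (a.mem_Icc_of_mem_vertices ha).2.trans (le_lastVertex hs b.source_mem_vertices)
  · rw [vertices_comp]
    exact Or.inl (lastVertex_mem_vertices hs b)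

theorem lastVertex_comp_of_lt {n : ℕ} (hr : r ≤ n) (hs : n < s) (b : PathHom s t)
    (a : PathHom r s) : (comp b a).lastVertex n = a.lastVertex n := by
  have hmem := lastVertex_mem_vertices hr (comp b a)
  rw [vertices_comp] at hmem
  refine le_antisymm (le_lastVertex (lastVertex_le n _) ?_) (le_lastVertex (a.lastVertex_le n) ?_)
  · refine hmem.resolve_left fun hb => ?_
    exact ((b.mem_Icc_of_mem_vertices hb).1.trans (lastVertex_le n _)).not_gt hs
  · rw [vertices_comp]
    exact Or.inr (lastVertex_mem_vertices hr a)

/-- The collapse of the ordered set of tuples to `[n]`. The last visited index is reversed, as it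
decreases when tuples increase. -/
def collapse (n : ℕ) : PathHom r s →o Fin (n + 1) where
  toFun a := ⟨n - a.lastVertex n, by omega⟩
  monotone' _ _ h := Nat.sub_le_sub_left (lastVertex_anti n h) n

/-- The tuple whose arrow visits `0, …, n - l` and `n + 1`. -/
def stair (n l : ℕ) : PathHom 0 (n + 1) where
  coord i := if (0 < i ∧ i ≤ n - l) ∨ i = n + 1 then 0 else 1
  le := Nat.zero_le _
  coord_eq_one i hi := if_neg (by omega)
  coord_last _ := if_pos (Or.inr rfl)

theorem mem_vertices_stair {n l i : ℕ} : i ∈ (stair n l).vertices ↔ i ≤ n - l ∨ i = n + 1 := by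
  simp only [vertices, stair, Set.mem_ofPred_eq, ite_eq_left_iff, one_ne_zero, imp_false]
  omega

theorem stair_mono (n : ℕ) : Monotone (stair n) := by
  intro l l' h
  rw [le_iff_zero]
  intro i
  simp only [stair, ite_eq_left_iff, one_ne_zero, imp_false]
  omega

theorem lastVertex_stair (n l : ℕ) : (stair n l).lastVertex n = n - l := by
  refine le_antisymm ?_ (le_lastVertex (Nat.sub_le _ _) (mem_vertices_stair.2 (Or.inl le_rfl)))
  have := mem_vertices_stair.1 (lastVertex_mem_vertices (Nat.zero_le n) (stair n l))
  have := (stair n l).lastVertex_le n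
  omega

theorem collapse_stair {n : ℕ} (l : Fin (n + 1)) : collapse n (stair n l) = l := by
  refine Fin.ext ?_
  change n - (stair n l).lastVertex n = l
  rw [lastVertex_stair]
  omega

end PathHom

theorem pathStrat_notMem_thin_of_strictAnti {r s m : ℕ} (x : (pathSSet.{u} r s) _⦋m⦌)
    {f : Fin m → ℕ} (hf : StrictAnti f)
    (jump : ∀ l, (x.obj l.castSucc).down.coord (f l) = 0 ∧ (x.obj l.succ).down.coord (f l) = 1) :
    x ∉ (pathStrat.{u} r s).thin m := by
  refine (pathStrat_notMem_thin x).2 ⟨fun l => if h : l < m then f ⟨l, h⟩ else 0, ?_, ?_⟩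
  · intro l l' hl hl'
    simp only [hl', hl.trans hl', dite_true]
    exact hf hl
  · intro l hl
    simp only [hl, dite_true]
    exact jump ⟨l, hl⟩

theorem pathStrat_isEmpty {r s : ℕ} (h : s < r) (m : SimplexCategoryᵒᵖ) :
    IsEmpty ((pathStrat.{u} r s).toSSet.obj m) :=
  ⟨fun x => h.not_ge ((x : (pathSSet.{u} r s).obj m).obj 0).down.le⟩

/-- The stratified map from the arrows `r ⟶ s` to the minimally stratified `Δ[n]` given by the
collapse of tuples. -/
def collapse (n r s : ℕ) : pathStrat.{u} r s ⟶ Strat.minimal (Δ[n] : SSet.{u}) where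
  toMap :=
    { app := fun _ => ↾fun x => SSet.stdSimplex.objMk
        ((PathHom.collapse n).comp ⟨fun v => (x.obj v).down, fun _ _ h => x.monotone h⟩)
      naturality := fun _ _ _ => rfl }
  map_thin m x hx := by
    change (pathSSet.{u} r s) _⦋m⦌ at x
    by_contra hnondeg
    have hmono := (SSet.stdSimplex.mem_nonDegenerate_iff_strictMono _).1 hnondeg
    have lastVertex_strictAnti : StrictAnti fun v : Fin (m + 1) => (x.obj v).down.lastVertex n :=
      fun v w hvw => (tsub_lt_tsub_iff_left_of_le (PathHom.lastVertex_le n _)).1 (hmono hvw)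
    refine pathStrat_notMem_thin_of_strictAnti x
      (lastVertex_strictAnti.comp_strictMono Fin.strictMono_castSucc) (fun l => ?_) hx
    exact PathHom.coord_lastVertex (lastVertex_strictAnti l.castSucc_lt_succ)

/-- The section of the collapse of the arrows `0 ⟶ n + 1` formed by the tuples
`PathHom.stair n 0 ≤ … ≤ PathHom.stair n n`. -/
def stair (n : ℕ) : Strat.minimal (Δ[n] : SSet.{u}) ⟶ pathStrat.{u} 0 (n + 1) where
  toMap :=
    { app := fun _ => ↾fun x => Monotone.functor
        (f := fun v => ULift.up (PathHom.stair n (SSet.stdSimplex.objEquiv x v)))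
        (fun _ _ h => PathHom.stair_mono n ((SSet.stdSimplex.objEquiv x).toOrderHom.monotone h))
      naturality := fun _ _ _ => rfl }
  map_thin _ _ hx := (pathStrat 0 (n + 1)).degenerate_subset _ (SSet.degenerate_app_apply hx _)

theorem stair_collapse (n : ℕ) : stair.{u} n ≫ collapse n 0 (n + 1) = 𝟙 _ :=
  Strat.hom_ext_of_stdSimplex fun _ _ _ => PathHom.collapse_stair _

section

variable {m : SimplexCategory} {n : ℕ} {r s t : PathObj m}

theorem eComp_collapse_of_le (hs : s.val ≤ n) :
    eComp Strat.{u}ᴹᵒᵖ r s t ≫ (collapse n r.val t.val).mop =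
      snd _ _ ≫ (collapse n s.val t.val).mop :=
  MonoidalOpposite.hom_ext (Strat.hom_ext_of_stdSimplex fun _ _ _ =>
    Fin.ext (congrArg (n - ·) (PathHom.lastVertex_comp_of_le hs _ _)))

theorem eComp_collapse_of_lt (hr : r.val ≤ n) (hs : n < s.val) :
    eComp Strat.{u}ᴹᵒᵖ r s t ≫ (collapse n r.val t.val).mop =
      fst _ _ ≫ (collapse n r.val s.val).mop :=
  MonoidalOpposite.hom_ext (Strat.hom_ext_of_stdSimplex fun _ _ _ =>
    Fin.ext (congrArg (n - ·) (PathHom.lastVertex_comp_of_lt hr hs _ _)))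

end

section

variable {C : Type*} [EnrichedCategory Strat.{u}ᴹᵒᵖ C] {X Y : C} {m : SimplexCategory} {n : ℕ}
  (x : .mop (Strat.minimal Δ[n]) ⟶ (X ⟶[Strat.{u}ᴹᵒᵖ] Y))

/-- The action on homs of `simplexPath`. The Booleans `p` and `q` record whether `r` and `s` lie
beyond `n`. -/
def simplexPathMap (r s : PathObj m) (p q : Bool) (hp : decide (n < r.val) = p)
    (hq : decide (n < s.val) = q) :
    (r ⟶[Strat.{u}ᴹᵒᵖ] s) ⟶ ((bif p then Y else X) ⟶[Strat.{u}ᴹᵒᵖ] (bif q then Y else X)) :=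
  match p, q, hp, hq with
  | false, false, _, _ => toUnit _ ≫ eId _ X
  | true, true, _, _ => toUnit _ ≫ eId _ Y
  | false, true, _, _ => (collapse n r.val s.val).mop ≫ x
  | true, false, hp, hq => ((Strat.isInitialOfIsEmpty (pathStrat_isEmpty
      ((not_lt.1 (of_decide_eq_false hq)).trans_lt (of_decide_eq_true hp)))).to _).mop

theorem simplexPathMap_id (r : PathObj m) (p : Bool) (hp : decide (n < r.val) = p) :
    eId _ r ≫ simplexPathMap x r r p p hp hp = eId _ _ := by
  cases p
  · exact (constEnrichedFunctor _ (PathObj m) X).map_id r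
  · exact (constEnrichedFunctor _ (PathObj m) Y).map_id r

theorem simplexPathMap_comp (r s t : PathObj m) (p q l : Bool) (hp : decide (n < r.val) = p)
    (hq : decide (n < s.val) = q) (hl : decide (n < t.val) = l) :
    eComp _ r s t ≫ simplexPathMap x r t p l hp hl =
      (simplexPathMap x r s p q hp hq ⊗ₘ simplexPathMap x s t q l hq hl) ≫ eComp _ _ _ _ := by
  match p, q, l, hp, hq, hl with
  | false, false, false, _, _, _ => exact (constEnrichedFunctor _ (PathObj m) X).map_comp r s t
  | true, true, true, _, _, _ => exact (constEnrichedFunctor _ (PathObj m) Y).map_comp r s t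
  | false, false, true, _, hq, _ =>
    have hs : s.val ≤ n := not_lt.1 (of_decide_eq_false hq)
    refine Eq.trans ?_ (toUnit_eId_tensorHom_eComp _).symm
    exact (Category.assoc _ _ _).symm.trans
      ((congrArg (· ≫ x) (eComp_collapse_of_le hs)).trans (Category.assoc _ _ _))
  | false, true, true, hp, hq, _ =>
    have hr : r.val ≤ n := not_lt.1 (of_decide_eq_false hp)
    have hs : n < s.val := of_decide_eq_true hq
    refine Eq.trans ?_ (tensorHom_toUnit_eId_eComp _).symm
    exact (Category.assoc _ _ _).symm.trans
      ((congrArg (· ≫ x) (eComp_collapse_of_lt hr hs)).trans (Category.assoc _ _ _))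
  | _, true, false, _, hq, hl =>
    have hts : t.val < s.val := (not_lt.1 (of_decide_eq_false hl)).trans_lt (of_decide_eq_true hq)
    exact MonoidalOpposite.hom_ext ((Strat.isInitialOfIsEmpty fun k =>
      ⟨fun (z : _ × _) => (pathStrat_isEmpty hts k).false z.1⟩).hom_ext _ _)
  | true, false, _, hp, hq, _ =>
    have hsr : s.val < r.val := (not_lt.1 (of_decide_eq_false hq)).trans_lt (of_decide_eq_true hp)
    exact MonoidalOpposite.hom_ext ((Strat.isInitialOfIsEmpty fun k =>
      ⟨fun (z : _ × _) => (pathStrat_isEmpty hsr k).false z.2⟩).hom_ext _ _)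

variable (m) in
/-- The enriched functor out of the generic path which extends the `n`-simplex `x` of a hom from
`X` to `Y`. It takes the value `X` at the objects `≤ n` and `Y` at the others. -/
def simplexPath : EnrichedFunctor Strat.{u}ᴹᵒᵖ (PathObj m) C where
  obj r := bif decide (n < r.val) then Y else X
  map r s := simplexPathMap x r s _ _ rfl rfl
  map_id r := simplexPathMap_id x r _ rfl
  map_comp r s t := simplexPathMap_comp x r s t _ _ _ rfl rfl rfl

theorem comp_map_eq_of_simplexPath_comp_eq {D : Type*} [EnrichedCategory Strat.{u}ᴹᵒᵖ D]
    {obj : C → D} {f g : ∀ X Y : C, (X ⟶[Strat.{u}ᴹᵒᵖ] Y) ⟶ obj X ⟶[Strat.{u}ᴹᵒᵖ] obj Y}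
    {h₁ h₂ h₃ h₄}
    (h : (simplexPath ⦋n + 1⦌ x).comp _ ⟨obj, f, h₁, h₂⟩ =
      (simplexPath ⦋n + 1⦌ x).comp _ ⟨obj, g, h₃, h₄⟩) :
    x ≫ f X Y = x ≫ g X Y := by
  have map_eq (r s : PathObj ⦋n + 1⦌) (p q : Bool) (hp : decide (n < r.val) = p)
      (hq : decide (n < s.val) = q) :
      simplexPathMap x r s p q hp hq ≫ f _ _ = simplexPathMap x r s p q hp hq ≫ g _ _ := by
    subst hp hq
    exact comp_map_eq_of_comp_eq _ h r s
  have collapse_eq : ((collapse n 0 (n + 1)).mop ≫ x) ≫ f X Y =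
      ((collapse n 0 (n + 1)).mop ≫ x) ≫ g X Y :=
    map_eq (0 : Fin (n + 2)) (Fin.last (n + 1)) false true (decide_eq_false n.not_lt_zero)
      (decide_eq_true n.lt_succ_self)
  have stair_comp_collapse : (stair.{u} n).mop ≫ (collapse n 0 (n + 1)).mop = 𝟙 _ :=
    MonoidalOpposite.hom_ext (stair_collapse n)
  simpa only [Category.assoc, reassoc_of% stair_comp_collapse] using
    congrArg ((stair.{u} n).mop ≫ ·) collapse_eq

end

theorem enrichedFunctor_ext_of_path {C : Type*} [EnrichedCategory Strat.{u}ᴹᵒᵖ C] {D : Type*}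
    [EnrichedCategory Strat.{u}ᴹᵒᵖ D] {F G : EnrichedFunctor Strat.{u}ᴹᵒᵖ C D}
    (h : ∀ (n : ℕ) (P : EnrichedFunctor Strat.{u}ᴹᵒᵖ (PathObj ⦋n⦌) C),
      P.comp _ F = P.comp _ G) : F = G := by
  obtain ⟨obj, f, _, _⟩ := F
  obtain ⟨obj', g, _, _⟩ := G
  obtain rfl : obj = obj' := funext fun X =>
    congrArg (fun P => P.obj (0 : Fin 1)) (h 0 (constEnrichedFunctor _ _ X))
  refine enrichedFunctor_ext obj fun X Y => MonoidalOpposite.hom_ext ?_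
  refine Strat.hom_ext_of_ofSimplex fun n y => ?_
  exact congrArg Quiver.Hom.unmop
    (comp_map_eq_of_simplexPath_comp_eq (Strat.ofSimplex y).mop (h (n + 1) _))

end StratGray

theorem mainTheorem2 : StratGray.stratNerve.{u, w}.Faithful where
  map_injective h := StratGray.enrichedFunctor_ext_of_path fun n P =>
    congrArg (fun k => k.app (op ⦋n⦌) P) h
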